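/- Let $a,b,c$ be real numbers with $1+c^2>a^2+b^2$, let $\sigma^2>0$, and let $X=\{X_{i,j}\}_{i,j\in\mathbb Z}$ and $\epsilon=\{\epsilon_{i,j}\}_{i,j\in\mathbb Z}$ be fields of real random variables with finite variances on a probability space $(\Omega,\mathcal F,\mathsf P)$. Suppose that $X$ is wide-sense stationary (its mean is constant and $\operatorname{cov}(X_{i,j},X_{i-h_1,j-h_2})$ depends only on $(h_1,h_2)$), that the $\epsilon_{i,j}$ are pairwise uncorrelated with zero mean and common variance $\sigma^2$ (for instance $\sigma^2=1$), and that for all $i,j\in\mathbb Z$, almost surely, \[ X_{i,j}=aX_{i-1,j}+bX_{i,j-1}+cX_{i-1,j-1}+\epsilon_{i,j}. \] Then $X$ is purely nondeterministic in Tjøstheim's sense, that is, in the real Hilbert space $L^2(\Omega,\mathcal F,\mathsf P)$, \[ \overline{\operatorname{span}}_{i,j}\,X_{i,j} =\overline{\operatorname{span}}_{i,j}\Bigl( \overline{\operatorname{span}}\{X_{r,s}:r\le i\}\cap\bigl(\overline{\operatorname{span}}\{X_{r,s}:r<i\}\bigr)^{\perp} \cap\overline{\operatorname{span}}\{X_{r,s}:s\le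 j\}\cap\bigl(\overline{\operatorname{span}}\{X_{r,s}:s<j\}\bigr)^{\perp}\Bigr), \] where $\overline{\operatorname{span}}$ denotes the smallest closed linear subspace containing the listed random variables or, on the outside of the right-hand side, containing the listed subspaces for all $i,j\in\mathbb Z$. -/

import Mathlib

open MeasureTheory ProbabilityTheory

noncomputable section

namespace PlanarAR

variable {Ω : Type*} [MeasurableSpace Ω]

/-- A wide-sense stationary field of real random variables on the lattice `ℤ × ℤ`: finite second
moments, constant mean, and autocovariance `cov (X i j) (X (i - h₁) (j - h₂))` depending only on
the lag `(h₁, h₂)`. -/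
structure IsStationaryField (X : ℤ → ℤ → Ω → ℝ) (μ : Measure Ω) : Prop where
  memLp : ∀ i j, MemLp (X i j) 2 μ
  mean : ∃ m : ℝ, ∀ i j, ∫ ω, X i j ω ∂μ = m
  autocov : ∃ γ : ℤ → ℤ → ℝ, ∀ i j h₁ h₂,
    covariance (X i j) (X (i - h₁) (j - h₂)) μ = γ h₁ h₂

/-- White noise with variance `v`: pairwise uncorrelated square-integrable random variables with
zero mean and common variance `v`. -/
structure IsWhiteNoise (ε : ℤ → ℤ → Ω → ℝ) (v : ℝ) (μ : Measure Ω) : Prop where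
  memLp : ∀ i j, MemLp (ε i j) 2 μ
  mean_zero : ∀ i j, ∫ ω, ε i j ω ∂μ = 0
  variance_eq : ∀ i j, variance (ε i j) μ = v
  uncorrelated : ∀ i j k l, (i, j) ≠ (k, l) → covariance (ε i j) (ε k l) μ = 0

/-- The planar AR(1) equation; for each `(i, j)`, it is an equality of random variables
(almost surely). -/
def SatisfiesAR (a b c : ℝ) (X ε : ℤ → ℤ → Ω → ℝ) (μ : Measure Ω) : Prop :=
  ∀ i j, ∀ᵐ ω ∂μ,
    X i j ω = a * X (i - 1) j ω + b * X i (j - 1) ω + c * X (i - 1) (j - 1) ω + ε i j ω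

/-- The smallest closed subspace of `L²(Ω, μ)` that contains the observations `X r s` with
`(r, s) ∈ I`. -/
def closedSpan {μ : Measure Ω} (X : ℤ → ℤ → Ω → ℝ) (hX : ∀ i j, MemLp (X i j) 2 μ)
    (I : Set (ℤ × ℤ)) : Submodule ℝ (Lp ℝ 2 μ) :=
  (Submodule.span ℝ ((fun p : ℤ × ℤ => (hX p.1 p.2).toLp (X p.1 p.2)) '' I)).topologicalClosure

/-- The part of the half-plane past `{r ≤ i}` orthogonal to the past `{r < i}`, intersected with
the part of the half-plane past `{s ≤ j}` orthogonal to the past `{s < j}`. -/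
def innovationSpace {μ : Measure Ω} (X : ℤ → ℤ → Ω → ℝ) (hX : ∀ i j, MemLp (X i j) 2 μ)
    (i j : ℤ) : Submodule ℝ (Lp ℝ 2 μ) :=
  closedSpan X hX {p | p.1 ≤ i} ⊓ (closedSpan X hX {p | p.1 < i})ᗮ ⊓
    closedSpan X hX {p | p.2 ≤ j} ⊓ (closedSpan X hX {p | p.2 < j})ᗮ

/-- Pure nondeterminism: the random variables have finite variance, and the closed span of the
whole field is the smallest closed subspace containing all the innovation spaces. -/
def IsPurelyNondeterministic (X : ℤ → ℤ → Ω → ℝ) (μ : Measure Ω) : Prop :=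
  ∃ hX : ∀ i j, MemLp (X i j) 2 μ,
    closedSpan X hX Set.univ = (⨆ i : ℤ, ⨆ j : ℤ, innovationSpace X hX i j).topologicalClosure

end PlanarAR

end

/-! Put `α = 1 + a² - b² - c²` and `β = a + bc`. For `|z| = 1`, `|1 - az|² - |b + cz|² = α - 2β Re
z`, so the symbol `1 - az - bw - czw` has no zero on the torus exactly when `2|β| < |α|`. A
stationary solution forces this (`symbol_ne_zero_of_stationary`): at a zero angle `θ₀` the limit
inferior of the periodograms of a row would dominate a multiple of `1/|θ - θ₀|`, while their
integrals over the circle do not depend on the sample length, against Fatou.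

If `|c| ≤ 1`, the hypothesis then gives `|a| < 1` and `2|β| < α` (`causal_of_symbol_ne_zero`). With
`U` the shift in the first index, the equation reads `(1 - aU) x_j = (b + cU) x_{j-1} + e_j`, and
`(1 - aU)⁻¹(b + cU)` is a strict contraction. Iteration puts each `X_{i,j}` in the closed span of
the noise over its quadrant past (`mem_closure_span_innovations`). Orthogonality of the noise then
places it in the innovation spaces, and it spans the whole field.

If `|c| > 1`, the same field satisfies an equation with coefficients `-b/c, -a/c, 1/c`. Its symbol
is a reflection of the original one, with modulus divided by `|c|` on the torus, so its residuals
are again orthogonal (`inner_reversed_innovations`) and the first case applies. -/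

namespace PlanarAR

open scoped InnerProductSpace
open Filter Topology

/-! ### Shift operators from Gram matrices -/

section Shift

variable {E : Type*} [NormedAddCommGroup E] [InnerProductSpace ℝ E] [CompleteSpace E]

/-- A bijection of the index set that preserves the Gram matrix of a family is implemented by a
linear isometry of the ambient Hilbert space. -/
theorem exists_isometry_of_gram {ι : Type*} (x : ι → E) (σ : ι ≃ ι)
    (hσ : ∀ i j, ⟪x (σ i), x (σ j)⟫_ℝ = ⟪x i, x j⟫_ℝ) :
    ∃ U : E →L[ℝ] E, (∀ y, ‖U y‖ = ‖y‖) ∧ ∀ i, U (x i) = x (σ i) := by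
  set H : Submodule ℝ E := (Submodule.span ℝ (Set.range x)).topologicalClosure with hH
  have hx : ∀ i, x i ∈ H := fun i =>
    Submodule.le_topologicalClosure _ (Submodule.subset_span ⟨i, rfl⟩)
  have : CompleteSpace H := (Submodule.isClosed_topologicalClosure _).completeSpace_coe
  let e : (ι →₀ ℝ) →ₗ[ℝ] H := Finsupp.linearCombination ℝ (fun i => (⟨x i, hx i⟩ : H))
  have he : ∀ f, ((e f : H) : E) = Finsupp.linearCombination ℝ x f := by
    intro f
    have := (Finsupp.apply_linearCombination ℝ H.subtype (fun i => (⟨x i, hx i⟩ : H)) f)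
    exact this
  have hdense : DenseRange e := by
    intro y
    rw [closure_subtype]
    have hy : (y : E) ∈ closure (Submodule.span ℝ (Set.range x) : Set E) := y.2
    refine closure_mono ?_ hy
    intro z hz
    rw [SetLike.mem_coe, Finsupp.mem_span_range_iff_exists_finsupp] at hz
    obtain ⟨f, hf⟩ := hz
    exact ⟨e f, ⟨f, rfl⟩, by rw [he, ← hf]; rfl⟩
  let F : (ι →₀ ℝ) ≃ₗ[ℝ] (ι →₀ ℝ) := Finsupp.domLCongr σ
  have hF : ∀ f, ‖e (F f)‖ = ‖e f‖ := by
    intro f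
    have h1 : ∀ f : ι →₀ ℝ, ‖e f‖ ^ 2 = f.sum fun i r => f.sum fun j s => r * (s * ⟪x i, x j⟫_ℝ) := by
      intro f
      change ‖((e f : H) : E)‖ ^ 2 = _
      rw [he, ← real_inner_self_eq_norm_sq, Finsupp.linearCombination_apply]
      simp only [Finsupp.sum, sum_inner, inner_sum, real_inner_smul_left, real_inner_smul_right]
      refine Finset.sum_congr rfl fun i _ => Finset.sum_congr rfl fun j _ => by
        rw [real_inner_comm, mul_left_comm]
    have h2 : ‖e (F f)‖ ^ 2 = ‖e f‖ ^ 2 := by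
      rw [h1, h1]
      simp only [F, Finsupp.domLCongr_apply, Finsupp.domCongr_apply, Finsupp.equivMapDomain_eq_mapDomain]
      rw [Finsupp.sum_mapDomain_index_inj σ.injective]
      refine Finsupp.sum_congr fun i _ => ?_
      rw [Finsupp.sum_mapDomain_index_inj σ.injective]
      simp only [hσ]
    exact (sq_eq_sq₀ (norm_nonneg _) (norm_nonneg _)).1 h2
  let V : H ≃ₗᵢ[ℝ] H := F.extendOfIsometry e e hdense hdense hF
  have hV : ∀ i, V ⟨x i, hx i⟩ = ⟨x (σ i), hx (σ i)⟩ := by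
    intro i
    have := F.extendOfIsometry_eq e e hdense hdense hF (Finsupp.single i 1)
    simpa [e, F, V] using this
  -- The isometry acts as `V` on `H` and as the identity on `Hᗮ`.
  refine ⟨H.subtypeL ∘L (V.toContinuousLinearEquiv : H →L[ℝ] H) ∘L H.orthogonalProjectionOnto +
    (ContinuousLinearMap.id ℝ E - H.subtypeL ∘L H.orthogonalProjectionOnto), ?_, ?_⟩
  · intro y
    rw [← sq_eq_sq₀ (norm_nonneg _) (norm_nonneg _)]
    have hy : y - (H.orthogonalProjectionOnto y : E) ∈ Hᗮ :=
      Submodule.sub_starProjection_mem_orthogonal y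
    have hsplit : ∀ z : H, ‖(z : E) + (y - (H.orthogonalProjectionOnto y : E))‖ ^ 2 =
        ‖z‖ ^ 2 + ‖y - (H.orthogonalProjectionOnto y : E)‖ ^ 2 := by
      intro z
      have := norm_add_sq_eq_norm_sq_add_norm_sq_real (hy z z.2)
      simpa [sq] using this
    have h1 := hsplit (V (H.orthogonalProjectionOnto y))
    have h2 := hsplit (H.orthogonalProjectionOnto y)
    rw [add_sub_cancel] at h2
    rw [V.norm_map] at h1
    rw [h2, ← h1]
    rfl
  · intro i
    have h1 : H.orthogonalProjectionOnto (x i) = ⟨x i, hx i⟩ :=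
      Submodule.orthogonalProjectionOnto_mem_subspace_eq_self (K := H) ⟨x i, hx i⟩
    simp [h1, hV]

end Shift

/-! ### Causal representation by a contraction -/

section Causal

variable {E : Type*} [NormedAddCommGroup E] [InnerProductSpace ℝ E]

/-- For an isometry `U`, the operator `b + c U` is strictly dominated by `1 - a U` when the
corresponding symbols are. -/
theorem norm_sq_add_le_of_isometry {a b c : ℝ} (U : E →L[ℝ] E) (hU : ∀ y, ‖U y‖ = ‖y‖)
    (h : 2 * |a + b * c| < 1 + a ^ 2 - b ^ 2 - c ^ 2) :
    ∃ ρ : ℝ, 0 ≤ ρ ∧ ρ < 1 ∧ ∀ y, ‖b • y + c • U y‖ ≤ ρ * ‖y - a • U y‖ := by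
  set d : ℝ := 1 + a ^ 2 - b ^ 2 - c ^ 2 - 2 * |a + b * c| with hd
  have hd0 : 0 < d := by linarith
  -- `‖y - aUy‖² - ‖by + cUy‖²` is at least `d‖y‖²`; dividing by `(1 + |a|)²` turns `‖y‖²` into a
  -- multiple of `‖y - aUy‖²`.
  set δ : ℝ := d / (1 + |a|) ^ 2 with hδ
  have ha : 0 < (1 + |a|) ^ 2 := by positivity
  have hδ0 : 0 < δ := div_pos hd0 ha
  have hδ1 : δ ≤ 1 := by
    rw [hδ, div_le_one ha]
    nlinarith [abs_nonneg a, abs_nonneg (a + b * c), sq_abs a, sq_nonneg b, sq_nonneg c]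
  refine ⟨√(1 - δ), Real.sqrt_nonneg _, ?_, fun y => ?_⟩
  · rw [Real.sqrt_lt' one_pos]; linarith
  have e1 : ‖b • y + c • U y‖ ^ 2 = (b ^ 2 + c ^ 2) * ‖y‖ ^ 2 + 2 * (b * c) * ⟪y, U y⟫_ℝ := by
    rw [norm_add_sq_real, real_inner_smul_left, real_inner_smul_right, norm_smul, norm_smul, hU,
      mul_pow, mul_pow, Real.norm_eq_abs, Real.norm_eq_abs, sq_abs, sq_abs]
    ring
  have e2 : ‖y - a • U y‖ ^ 2 = (1 + a ^ 2) * ‖y‖ ^ 2 - 2 * a * ⟪y, U y⟫_ℝ := by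
    rw [norm_sub_sq_real, real_inner_smul_right, norm_smul, hU, mul_pow, Real.norm_eq_abs, sq_abs]
    ring
  have e3 : ‖y - a • U y‖ ≤ (1 + |a|) * ‖y‖ := by
    refine (norm_sub_le _ _).trans ?_
    rw [norm_smul, hU, Real.norm_eq_abs]; linarith
  have e4 : (a + b * c) * ⟪y, U y⟫_ℝ ≤ |a + b * c| * ‖y‖ ^ 2 := by
    refine (le_abs_self _).trans ?_
    rw [abs_mul]
    gcongr
    refine (abs_real_inner_le_norm _ _).trans ?_
    rw [hU, sq]
  have e5 : δ * ‖y - a • U y‖ ^ 2 ≤ d * ‖y‖ ^ 2 := by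
    calc δ * ‖y - a • U y‖ ^ 2 ≤ δ * ((1 + |a|) * ‖y‖) ^ 2 := by gcongr
      _ = d * ‖y‖ ^ 2 := by rw [hδ]; field_simp
  have e6 : ‖b • y + c • U y‖ ^ 2 ≤ (√(1 - δ) * ‖y - a • U y‖) ^ 2 := by
    rw [mul_pow, Real.sq_sqrt (by linarith)]
    nlinarith
  exact le_of_sq_le_sq e6 (by positivity)

variable [CompleteSpace E]

/-- Causality: a stationary family solving the planar autoregression lies in the closed span of
the quadrant past of its innovations. -/
theorem mem_closure_span_innovations {a b c : ℝ} (x e : ℤ → ℤ → E)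
    (hx : ∀ i j k l, ⟪x (i - 1) j, x (k - 1) l⟫_ℝ = ⟪x i j, x k l⟫_ℝ)
    (hb : ∃ C, ∀ i j, ‖x i j‖ ≤ C)
    (he : ∀ i j, x i j = a • x (i - 1) j + b • x i (j - 1) + c • x (i - 1) (j - 1) + e i j)
    (ha : |a| < 1) (h : 2 * |a + b * c| < 1 + a ^ 2 - b ^ 2 - c ^ 2) (i j : ℤ) :
    x i j ∈ (Submodule.span ℝ
      ((fun p : ℤ × ℤ => e p.1 p.2) '' {p | p.1 ≤ i ∧ p.2 ≤ j})).topologicalClosure := by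
  obtain ⟨U, hU, hUx⟩ := exists_isometry_of_gram (fun p : ℤ × ℤ => x p.1 p.2)
    ((Equiv.subRight (1 : ℤ)).prodCongr (Equiv.refl ℤ)) (fun p q => by simpa using hx _ _ _ _)
  replace hUx : ∀ i j, U (x i j) = x (i - 1) j := fun i j => by simpa using hUx (i, j)
  obtain ⟨C, hC⟩ := hb
  obtain ⟨ρ, hρ0, hρ1, hρ⟩ := norm_sq_add_le_of_isometry U hU h
  have hUe : ∀ i j, U (e i j) = e (i - 1) j := by
    intro i j
    have h1 : ∀ i j, e i j =
        x i j - (a • x (i - 1) j + b • x i (j - 1) + c • x (i - 1) (j - 1)) := fun i j => by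
      rw [he i j]; simp
    rw [h1, h1]
    simp only [map_sub, map_add, map_smul, hUx]
  set K : ℤ → Submodule ℝ E := fun j => (Submodule.span ℝ
      ((fun p : ℤ × ℤ => e p.1 p.2) '' {p | p.1 ≤ i ∧ p.2 ≤ j})).topologicalClosure with hK
  have hKcl : ∀ j, IsClosed (K j : Set E) := fun j => Submodule.isClosed_topologicalClosure _
  have hKmono : ∀ {j j'}, j ≤ j' → K j ≤ K j' := fun hj =>
    Submodule.topologicalClosure_mono (Submodule.span_mono (Set.image_mono
      fun p hp => ⟨hp.1, hp.2.trans hj⟩))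
  have hKe : ∀ j, e i j ∈ K j := fun j => Submodule.le_topologicalClosure _
    (Submodule.subset_span ⟨(i, j), ⟨le_rfl, le_rfl⟩, rfl⟩)
  have hKU : ∀ j, ∀ y ∈ K j, U y ∈ K j := by
    intro j y hy
    have hle : K j ≤ (K j).comap (U : E →ₗ[ℝ] E) := by
      refine Submodule.topologicalClosure_minimal _ (Submodule.span_le.2 ?_)
        ((hKcl j).preimage U.continuous)
      rintro _ ⟨p, hp, rfl⟩
      change U (e p.1 p.2) ∈ K j
      rw [hUe]
      exact Submodule.le_topologicalClosure _
        (Submodule.subset_span ⟨(p.1 - 1, p.2), ⟨by have := hp.1; simp at this ⊢; omega, hp.2⟩, rfl⟩)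
    exact hle hy
  have hnorm : ‖a • U‖ < 1 := by
    refine lt_of_le_of_lt ?_ ha
    refine ContinuousLinearMap.opNorm_le_bound _ (abs_nonneg a) fun y => ?_
    rw [smul_apply, norm_smul, hU, Real.norm_eq_abs]
  let A : (E →L[ℝ] E)ˣ := Units.oneSub (a • U) hnorm
  have hA : (A : E →L[ℝ] E) = 1 - a • U := rfl
  let S : E →L[ℝ] E := ((A⁻¹ : (E →L[ℝ] E)ˣ) : E →L[ℝ] E)
  have hAS : ∀ y, S y - a • U (S y) = y := fun y => by
    have : ((A : E →L[ℝ] E) * S) y = y := by rw [Units.mul_inv]; rfl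
    exact this
  have hSA : ∀ y, S (y - a • U y) = y := fun y => by
    have : (S * (A : E →L[ℝ] E)) y = y := by rw [Units.inv_mul]; rfl
    exact this
  have hSU : ∀ y, S (U y) = U (S y) := by
    intro y
    conv_lhs => rw [← hAS y]
    rw [map_sub, map_smul, hSA]
  -- The Neumann series for `(1 - aU)⁻¹` has only nonnegative powers of `U`, so it never leaves the
  -- past.
  have hKS : ∀ j, ∀ y ∈ K j, S y ∈ K j := by
    intro j y hy
    have hs : HasSum (fun n : ℕ => (a • U) ^ n) S := by
      have := (summable_geometric_of_norm_lt_one hnorm).hasSum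
      exact this
    have hs' := hs.mapL (ContinuousLinearMap.apply ℝ E y)
    refine (hKcl j).mem_of_tendsto hs' (Eventually.of_forall fun s =>
      Submodule.sum_mem _ fun n hn => ?_)
    clear hn
    induction n with
    | zero => simpa using hy
    | succ n ih =>
      have : ((a • U) ^ (n + 1)) y = a • U (((a • U) ^ n) y) := by rw [pow_succ']; rfl
      change ((a • U) ^ (n + 1)) y ∈ K j
      rw [this]
      exact Submodule.smul_mem _ _ (hKU j _ ih)
  let T : E →L[ℝ] E := S ∘L (b • ContinuousLinearMap.id ℝ E + c • U)
  have hTapp : ∀ y, T y = b • S y + c • U (S y) := fun y => by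
    simp [T, hSU]
  have hTn : ∀ y, ‖T y‖ ≤ ρ * ‖y‖ := fun y => by
    rw [hTapp]
    simpa [hAS y] using hρ (S y)
  have hTK : ∀ j, ∀ y ∈ K j, T y ∈ K j := fun j y hy => by
    rw [hTapp]
    exact Submodule.add_mem _ (Submodule.smul_mem _ _ (hKS j y hy))
      (Submodule.smul_mem _ _ (hKU j _ (hKS j y hy)))
  have hrec : ∀ j, x i j = S (e i j) + T (x i (j - 1)) := by
    intro j
    have h1 : x i j - a • U (x i j) = e i j + (b • x i (j - 1) + c • U (x i (j - 1))) := by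
      rw [hUx, hUx]
      conv_lhs => rw [he i j]
      abel
    rw [← hSA (x i j), h1, map_add]
    simp [T]
  -- Unrolling the recursion `n` times leaves the remainder `Tⁿ x_{i,j-n}`, which vanishes in the
  -- limit because `x` is bounded.
  have hmem : ∀ n : ℕ, ∀ j, x i j - (T ^ n) (x i (j - n)) ∈ K j := by
    intro n
    induction n with
    | zero => simp
    | succ n ih =>
      intro j
      have h1 := hKmono (sub_one_lt j).le (ih (j - 1))
      have h2 : x i j - (T ^ (n + 1)) (x i (j - (n + 1 : ℕ))) =
          S (e i j) + T (x i (j - 1) - (T ^ n) (x i (j - 1 - n))) := by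
        rw [map_sub, ← add_sub_assoc, ← hrec j, pow_succ']
        push_cast
        rw [sub_sub, add_comm (1 : ℤ)]
        rfl
      rw [h2]
      exact Submodule.add_mem _ (hKS j _ (hKe j)) (hTK j _ h1)
  have hlim : Tendsto (fun n : ℕ => x i j - (T ^ n) (x i (j - n))) atTop (𝓝 (x i j)) := by
    have hpow : ∀ n : ℕ, ∀ y, ‖(T ^ n) y‖ ≤ ρ ^ n * ‖y‖ := by
      intro n y
      induction n with
      | zero => simp
      | succ n ih =>
        have : (T ^ (n + 1)) y = T ((T ^ n) y) := by rw [pow_succ']; rfl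
        rw [this, pow_succ', mul_assoc]
        exact (hTn _).trans (by gcongr)
    have h0 : Tendsto (fun n : ℕ => (T ^ n) (x i (j - n))) atTop (𝓝 0) := by
      refine squeeze_zero_norm (fun n => (hpow n _).trans
        (mul_le_mul_of_nonneg_left (hC _ _) (pow_nonneg hρ0 n))) ?_
      simpa using (tendsto_pow_atTop_nhds_zero_of_lt_one hρ0 hρ1).mul_const C
    simpa using tendsto_const_nhds.sub h0
  exact (hKcl j).mem_of_tendsto hlim (Eventually.of_forall fun n => hmem n j)

end Causal

/-! ### Periodograms and zeros of the symbol -/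

section Spectral

/-- Since `(P - Q)S = P^M - Q^M` for the sum `S`, the ratio `(P^M + Q^M)/S` tends to `|P - Q|` when
`P ≠ Q`; when `P = Q > 0` it is `2P/M`. The factor 2 leaves room for a finite `M`. -/
theorem exists_geom_sum₂_ge {P Q t : ℝ} (hP : 0 ≤ P) (hQ : 0 ≤ Q) (ht : 0 < t)
    (h : |P - Q| ≤ t) :
    ∃ M : ℕ, 0 < ∑ m ∈ Finset.range M, P ^ m * Q ^ (M - 1 - m) ∧
      P ^ M + Q ^ M ≤ 2 * t * ∑ m ∈ Finset.range M, P ^ m * Q ^ (M - 1 - m) := by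
  wlog hPQ : Q ≤ P generalizing P Q
  · obtain ⟨M, h1, h2⟩ := this hQ hP (by rwa [abs_sub_comm]) (le_of_not_ge hPQ)
    rw [(Commute.all Q P).geom_sum₂_comm] at h1 h2
    exact ⟨M, h1, by rwa [add_comm]⟩
  rcases hP.eq_or_lt with rfl | hP0
  · obtain rfl : Q = 0 := le_antisymm hPQ hQ
    exact ⟨1, by simp, by simpa using ht.le⟩
  rcases hPQ.eq_or_lt with rfl | hlt
  · obtain ⟨n, hn⟩ := exists_nat_ge (Q / t)
    rw [div_le_iff₀ ht] at hn
    have hS : ∑ m ∈ Finset.range (n + 1), Q ^ m * Q ^ (n + 1 - 1 - m) = (n + 1) * Q ^ n := by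
      rw [Finset.sum_congr rfl (g := fun _ => Q ^ n)]
      · simp
      · intro m hm
        rw [← pow_add]
        congr 1
        have := Finset.mem_range.1 hm
        omega
    refine ⟨n + 1, ?_, ?_⟩
    · rw [hS]; positivity
    · rw [hS, pow_succ]
      have : 0 < Q ^ n := by positivity
      nlinarith
  · have hlim := tendsto_pow_atTop_nhds_zero_of_lt_one (div_nonneg hQ hP)
      ((div_lt_one hP0).2 hlt)
    -- The threshold `1/3` is where `(1 + q)/(1 - q) = 2`.
    obtain ⟨M, hM⟩ := (hlim.eventually (gt_mem_nhds (show (0 : ℝ) < 1 / 3 by norm_num))).exists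
    have hPM : 0 < P ^ M := by positivity
    rw [div_pow, div_lt_iff₀ hPM] at hM
    have hS := (Commute.all P Q).geom_sum₂_mul M
    have hQM : 0 ≤ Q ^ M := by positivity
    set S := ∑ m ∈ Finset.range M, P ^ m * Q ^ (M - 1 - m)
    have hd : 0 < P - Q := sub_pos.2 hlt
    have hS0 : 0 < S := by
      by_contra hneg
      nlinarith
    refine ⟨M, hS0, ?_⟩
    rw [abs_of_pos hd] at h
    nlinarith

theorem lintegral_inv_abs_sub_eq_top {a b x₀ C : ℝ} (hab : a < b) (h₀ : x₀ ∈ Set.Icc a b)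
    (hC : 0 < C) : ∫⁻ x in Set.Ioc a b, ENNReal.ofReal (C * |x - x₀|⁻¹) = ⊤ := by
  by_contra hfin
  have h1 : IntervalIntegrable (fun x : ℝ => C * (x - x₀)⁻¹) volume a b := by
    rw [intervalIntegrable_iff_integrableOn_Ioc_of_le hab.le]
    refine ⟨by fun_prop, ?_⟩
    rw [hasFiniteIntegral_iff_norm]
    simpa [abs_of_pos hC] using lt_top_iff_ne_top.2 hfin
  have h2 : IntervalIntegrable (fun x : ℝ => (x - x₀)⁻¹) volume a b := by
    have := h1.const_mul C⁻¹
    simpa [← mul_assoc, inv_mul_cancel₀ hC.ne'] using this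
  rw [intervalIntegrable_sub_inv_iff] at h2
  rcases h2 with h2 | h2
  · exact hab.ne h2
  · exact h2 (by rwa [Set.uIcc_of_le hab.le])

variable {E : Type*} [NormedAddCommGroup E] [InnerProductSpace ℂ E]

theorem norm_sq_sum_smul_of_orthogonal {ι : Type*} (s : Finset ι) (w : ι → E) (c : ι → ℂ) {V : ℝ}
    (ho : ∀ i j, i ≠ j → ⟪w i, w j⟫_ℂ = 0) (hV : ∀ i, ‖w i‖ ^ 2 = V) :
    ‖∑ i ∈ s, c i • w i‖ ^ 2 = V * ∑ i ∈ s, ‖c i‖ ^ 2 := by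
  have h : ((‖∑ i ∈ s, c i • w i‖ ^ 2 : ℝ) : ℂ) = ((V * ∑ i ∈ s, ‖c i‖ ^ 2 : ℝ) : ℂ) := by
    have h0 := inner_self_eq_norm_sq_to_K (𝕜 := ℂ) (∑ i ∈ s, c i • w i)
    push_cast
    refine h0.symm.trans ?_
    rw [sum_inner, Finset.mul_sum]
    refine Finset.sum_congr rfl fun i hi => ?_
    rw [inner_sum, Finset.sum_eq_single_of_mem i hi]
    · have h1 := inner_self_eq_norm_sq_to_K (𝕜 := ℂ) (w i)
      rw [inner_smul_left, inner_smul_right, h1, ← Complex.conj_mul', ← hV i]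
      push_cast
      simp only [Complex.coe_algebraMap]
      ring
    · intro j _ hj
      rw [inner_smul_left, inner_smul_right, ho i j hj.symm]
      simp
  exact_mod_cast h

/-- The discrete Fourier transform of the first `N` entries of the `j`-th row. -/
def rowSum (x : ℤ → ℤ → E) (N : ℕ) (z : ℂ) (j : ℤ) : E :=
  ∑ k ∈ Finset.range N, z ^ k • x k j

theorem sum_pow_smul_shift (x : ℤ → ℤ → E) (N : ℕ) (z : ℂ) (j : ℤ) :
    ∑ k ∈ Finset.range N, z ^ k • x (k - 1) j =
      z • rowSum x N z j + (x (-1) j - z ^ N • x (N - 1) j) := by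
  induction N with
  | zero => simp [rowSum]
  | succ N ih =>
    rw [Finset.sum_range_succ, ih, rowSum, rowSum, Finset.sum_range_succ, smul_add, smul_smul,
      ← pow_succ']
    push_cast
    rw [add_sub_cancel_right]
    abel

/-- Under the Fourier transform the shift in the first index becomes multiplication by `z`, up to
boundary terms whose norm stays bounded in `N` for a stationary field and `|z| = 1`. -/
theorem rowSum_ar {a b c : ℂ} {x e : ℤ → ℤ → E}
    (he : ∀ i j, x i j = a • x (i - 1) j + b • x i (j - 1) + c • x (i - 1) (j - 1) + e i j)
    (N : ℕ) (z : ℂ) (j : ℤ) :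
    (1 - a * z) • rowSum x N z j - (b + c * z) • rowSum x N z (j - 1) =
      rowSum e N z j + (a • (x (-1) j - z ^ N • x (N - 1) j) +
        c • (x (-1) (j - 1) - z ^ N • x (N - 1) (j - 1))) := by
  have h : rowSum x N z j = a • (∑ k ∈ Finset.range N, z ^ k • x (k - 1) j) +
      b • rowSum x N z (j - 1) + c • (∑ k ∈ Finset.range N, z ^ k • x (k - 1) (j - 1)) +
      rowSum e N z j := by
    simp only [rowSum, Finset.smul_sum, ← Finset.sum_add_distrib]
    refine Finset.sum_congr rfl fun k _ => ?_
    rw [he k j]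
    simp only [smul_add, smul_smul, mul_comm]
  rw [sum_pow_smul_shift, sum_pow_smul_shift] at h
  rw [sub_smul, one_smul]
  conv_lhs => enter [1, 1]; rw [h]
  module

theorem iterate_ar {A B : ℂ} {R w : ℤ → E} (h : ∀ j, A • R j - B • R (j - 1) = w j) (M : ℕ) :
    A ^ M • R 0 - B ^ M • R (-M) =
      ∑ m ∈ Finset.range M, (B ^ m * A ^ (M - 1 - m)) • w (-m) := by
  induction M with
  | zero => simp
  | succ M ih =>
    have h1 : ∑ m ∈ Finset.range M, (B ^ m * A ^ (M + 1 - 1 - m)) • w (-m) =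
        A • ∑ m ∈ Finset.range M, (B ^ m * A ^ (M - 1 - m)) • w (-m) := by
      rw [Finset.smul_sum]
      refine Finset.sum_congr rfl fun m hm => ?_
      have := Finset.mem_range.1 hm
      rw [smul_smul, show M + 1 - 1 - m = (M - 1 - m) + 1 by omega, pow_succ]
      congr 1; ring
    rw [Finset.sum_range_succ, h1, ← ih, ← h, show (-((M + 1 : ℕ) : ℤ)) = -M - 1 by push_cast; ring]
    simp only [Nat.add_sub_cancel, Nat.sub_self, pow_zero, mul_one]
    module

/-- The right side does not involve `j`: all rows have the same periodogram. -/
theorem norm_sq_rowSum_exp {x : ℤ → ℤ → E} {g : ℤ → ℝ}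
    (hg : ∀ i k j, ⟪x i j, x k j⟫_ℂ = (g (i - k) : ℂ)) (N : ℕ) (θ : ℝ) (j : ℤ) :
    ‖rowSum x N (Complex.exp (θ * Complex.I)) j‖ ^ 2 =
      ∑ k ∈ Finset.range N, ∑ l ∈ Finset.range N,
        g ((k : ℤ) - l) * Real.cos ((((k : ℤ) - l : ℤ) : ℝ) * θ) := by
  rw [← inner_self_eq_norm_sq (𝕜 := ℂ), rowSum, sum_inner, map_sum]
  refine Finset.sum_congr rfl fun k _ => ?_
  rw [inner_sum, map_sum]
  refine Finset.sum_congr rfl fun l _ => ?_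
  rw [inner_smul_left, inner_smul_right, hg, ← Complex.exp_nat_mul, ← Complex.exp_nat_mul,
    ← Complex.exp_conj, ← mul_assoc, ← Complex.exp_add]
  have : (starRingEnd ℂ) (k * (θ * Complex.I)) + l * (θ * Complex.I) =
      ((-((((k : ℤ) - l : ℤ) : ℝ) * θ) : ℝ) : ℂ) * Complex.I := by
    simp
    ring
  rw [this]
  simp only [RCLike.re_to_complex, Complex.re_mul_ofReal, Complex.exp_ofReal_mul_I_re, Real.cos_neg]
  ring

theorem integral_cos_int_mul (n : ℤ) :
    ∫ θ in (0 : ℝ)..(2 * Real.pi), Real.cos (n * θ) = if n = 0 then 2 * Real.pi else 0 := by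
  split_ifs with h
  · simp [h]
  · rw [intervalIntegral.integral_comp_mul_left _ (by exact_mod_cast h), integral_cos]
    have : Real.sin (n * (2 * Real.pi)) = 0 := by
      have := Real.sin_int_mul_pi (n * 2)
      push_cast at this
      rw [← this]; ring_nf
    simp [this]

theorem continuous_rowSum_exp (x : ℤ → ℤ → E) (N : ℕ) (j : ℤ) :
    Continuous fun θ : ℝ => rowSum x N (Complex.exp (θ * Complex.I)) j := by
  unfold rowSum
  fun_prop

theorem integral_norm_sq_rowSum {x : ℤ → ℤ → E} {g : ℤ → ℝ}
    (hg : ∀ i k j, ⟪x i j, x k j⟫_ℂ = (g (i - k) : ℂ)) (N : ℕ) (j : ℤ) :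
    ∫ θ in (0 : ℝ)..(2 * Real.pi), ‖rowSum x N (Complex.exp (θ * Complex.I)) j‖ ^ 2 =
      N * (2 * Real.pi * g 0) := by
  simp only [norm_sq_rowSum_exp hg]
  rw [intervalIntegral.integral_finsetSum]
  · rw [Finset.sum_congr rfl (g := fun _ => 2 * Real.pi * g 0)]
    · simp
    intro k hk
    rw [intervalIntegral.integral_finsetSum]
    · simp only [intervalIntegral.integral_const_mul, integral_cos_int_mul]
      rw [Finset.sum_eq_single_of_mem k hk]
      · simp [mul_comm]
      · intro l _ hl
        rw [if_neg (by omega), mul_zero]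
    · intro l _
      exact Continuous.intervalIntegrable (by fun_prop) _ _
  · intro k _
    exact Continuous.intervalIntegrable (by fun_prop) _ _

/-- Lower bound for the periodogram of a row of a stationary solution. -/
theorem eventually_le_norm_sq_rowSum {a b c v : ℝ} (hv : 0 < v) {x e : ℤ → ℤ → E} {g : ℤ → ℝ}
    (hg : ∀ i k j, ⟪x i j, x k j⟫_ℂ = (g (i - k) : ℂ))
    (he : ∀ i j, x i j = (a : ℂ) • x (i - 1) j + (b : ℂ) • x i (j - 1) +
      (c : ℂ) • x (i - 1) (j - 1) + e i j)
    (ho : ∀ i j k l, (i, j) ≠ (k, l) → ⟪e i j, e k l⟫_ℂ = 0) (hev : ∀ i j, ‖e i j‖ ^ 2 = v)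
    {θ t : ℝ} (ht : 0 < t)
    (hθ : |1 + a ^ 2 - b ^ 2 - c ^ 2 - 2 * (a + b * c) * Real.cos θ| ≤ t) :
    ∀ᶠ N : ℕ in atTop,
      v / (16 * t) ≤ ‖rowSum x N (Complex.exp (θ * Complex.I)) 0‖ ^ 2 / N := by
  set z : ℂ := Complex.exp (θ * Complex.I) with hz
  have hz1 : ‖z‖ = 1 := Complex.norm_exp_ofReal_mul_I θ
  have hzre : z.re = Real.cos θ := Complex.exp_ofReal_mul_I_re θ
  have hzim : z.im = Real.sin θ := Complex.exp_ofReal_mul_I_im θ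
  set A : ℂ := 1 - a * z with hA
  set B : ℂ := b + c * z with hB
  have hP : ‖A‖ ^ 2 = 1 + a ^ 2 - 2 * a * Real.cos θ := by
    rw [← Complex.normSq_eq_norm_sq, Complex.normSq_apply]
    simp [hA, hzre, hzim]
    linear_combination a ^ 2 * Real.sin_sq_add_cos_sq θ
  have hQ : ‖B‖ ^ 2 = b ^ 2 + c ^ 2 + 2 * b * c * Real.cos θ := by
    rw [← Complex.normSq_eq_norm_sq, Complex.normSq_apply]
    simp [hB, hzre, hzim]
    linear_combination c ^ 2 * Real.sin_sq_add_cos_sq θ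
  -- `M` depends on `θ` and `t` but not on `N`, so the accumulated boundary error `D` is constant as
  -- `N` grows.
  obtain ⟨M, hS0, hS⟩ := exists_geom_sum₂_ge (sq_nonneg ‖B‖) (sq_nonneg ‖A‖) ht
    (by rw [abs_sub_comm, hP, hQ]; convert hθ using 2; ring)
  set S := ∑ m ∈ Finset.range M, (‖B‖ ^ 2) ^ m * (‖A‖ ^ 2) ^ (M - 1 - m) with hSdef
  have hxn : ∀ i j, ‖x i j‖ = √(g 0) := by
    intro i j
    have h1 : ‖x i j‖ ^ 2 = g 0 := by
      rw [← inner_self_eq_norm_sq (𝕜 := ℂ), hg]; simp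
    rw [← h1, Real.sqrt_sq (norm_nonneg _)]
  set κ : ℝ := (|a| + |c|) * (2 * √(g 0)) with hκ
  set D : ℝ := ∑ m ∈ Finset.range M, ‖B ^ m * A ^ (M - 1 - m)‖ * κ with hD
  -- Iterating over `M` rows gives an orthogonal noise sum of squared norm `N v S`, whereas the two
  -- end terms have norm at most `(‖A‖^M + ‖B‖^M) r`.
  have key : ∀ N : ℕ, √N * √v * √S ≤ 2 * √t * √S * ‖rowSum x N z 0‖ + D := by
    intro N
    set r := ‖rowSum x N z 0‖ with hr
    have hrj : ∀ j, ‖rowSum x N z j‖ = r := by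
      intro j
      rw [hr, ← sq_eq_sq₀ (norm_nonneg _) (norm_nonneg _), hz, norm_sq_rowSum_exp hg,
        norm_sq_rowSum_exp hg]
    set η : ℤ → E := fun j => (a : ℂ) • (x (-1) j - z ^ N • x (N - 1) j) +
        (c : ℂ) • (x (-1) (j - 1) - z ^ N • x (N - 1) (j - 1)) with hη
    have hηn : ∀ j, ‖η j‖ ≤ κ := by
      have hδ : ∀ j, ‖x (-1) j - z ^ N • x (N - 1) j‖ ≤ 2 * √(g 0) := by
        intro j
        refine (norm_sub_le _ _).trans ?_
        rw [norm_smul, norm_pow, hz1, hxn, hxn]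
        simp [two_mul]
      intro j
      refine (norm_add_le _ _).trans ?_
      rw [norm_smul, norm_smul, Complex.norm_real, Complex.norm_real, hκ, add_mul]
      exact add_le_add (mul_le_mul_of_nonneg_left (hδ _) (abs_nonneg _))
        (mul_le_mul_of_nonneg_left (hδ _) (abs_nonneg _))
    have hit := iterate_ar (A := A) (B := B) (R := rowSum x N z)
      (w := fun j => rowSum e N z j + η j) (fun j => rowSum_ar he N z j) M
    have hWn : ∀ j, ‖rowSum e N z j‖ ^ 2 = N * v := by
      intro j
      rw [rowSum, norm_sq_sum_smul_of_orthogonal (V := v) _ (fun k : ℕ => e k j)]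
      · simp [hz1, mul_comm]
      · intro k l hkl
        exact ho _ _ _ _ (by simpa using hkl)
      · intro k; exact hev _ _
    have hWo : ∀ j l, j ≠ l → ⟪rowSum e N z j, rowSum e N z l⟫_ℂ = 0 := by
      intro j l hjl
      simp only [rowSum, sum_inner, inner_sum]
      refine Finset.sum_eq_zero fun k _ => Finset.sum_eq_zero fun k' _ => ?_
      rw [inner_smul_left, inner_smul_right, ho _ _ _ _ (by simp [hjl])]
      simp
    have hmain : ‖∑ m ∈ Finset.range M, (B ^ m * A ^ (M - 1 - m)) • rowSum e N z (-m)‖ =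
        √N * √v * √S := by
      rw [← Real.sqrt_sq (norm_nonneg _), norm_sq_sum_smul_of_orthogonal (V := N * v) _
        (fun m : ℕ => rowSum e N z (-m)), Real.sqrt_mul (by positivity),
        Real.sqrt_mul (by positivity)]
      · congr 2
        refine Finset.sum_congr rfl fun m _ => ?_
        rw [norm_mul, norm_pow, norm_pow, mul_pow, ← pow_mul, ← pow_mul, ← pow_mul, ← pow_mul,
          mul_comm m, mul_comm (M - 1 - m)]
      · intro k l hkl
        exact hWo _ _ (by simpa using hkl)
      · intro k; exact hWn _
    have herr : ‖∑ m ∈ Finset.range M, (B ^ m * A ^ (M - 1 - m)) • η (-m)‖ ≤ D := by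
      refine (norm_sum_le _ _).trans (Finset.sum_le_sum fun m _ => ?_)
      rw [norm_smul]
      exact mul_le_mul_of_nonneg_left (hηn _) (norm_nonneg _)
    have hlhs : ‖A ^ M • rowSum x N z 0 - B ^ M • rowSum x N z (-M)‖ ≤ 2 * √t * √S * r := by
      refine (norm_sub_le _ _).trans ?_
      rw [norm_smul, norm_smul, hrj, hrj, ← add_mul, norm_pow, norm_pow]
      refine mul_le_mul_of_nonneg_right ?_ (norm_nonneg _)
      refine le_of_sq_le_sq ?_ (by positivity)
      rw [mul_pow, mul_pow, Real.sq_sqrt ht.le, Real.sq_sqrt hS0.le]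
      rw [← pow_mul, ← pow_mul, mul_comm 2 M, pow_mul, pow_mul] at hS
      nlinarith [sq_nonneg (‖A‖ ^ M - ‖B‖ ^ M)]
    rw [← hmain]
    simp only [smul_add, Finset.sum_add_distrib] at hit
    rw [← sub_eq_iff_eq_add] at hit
    rw [← hit]
    exact (norm_sub_le _ _).trans (add_le_add hlhs herr)
  have hlim : Tendsto (fun N : ℕ => √(N : ℝ)) atTop atTop :=
    Real.tendsto_sqrt_atTop.comp tendsto_natCast_atTop_atTop
  filter_upwards [hlim.eventually_ge_atTop (2 * D / (√v * √S)), eventually_gt_atTop 0] with N h1 h2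
  have hvS : 0 < √v * √S := mul_pos (Real.sqrt_pos.2 hv) (Real.sqrt_pos.2 hS0)
  rw [div_le_iff₀ hvS] at h1
  have h3 := key N
  have hN : (0 : ℝ) < N := by exact_mod_cast h2
  -- For large `N`, `D` is at most half of the noise term. This doubles the constant 2 to 4, whose
  -- square is the 16.
  have h4 : √N * √v ≤ 4 * √t * ‖rowSum x N z 0‖ := by
    have hsS : 0 < √S := Real.sqrt_pos.2 hS0
    by_contra hneg
    push Not at hneg
    nlinarith
  have h5 : N * v ≤ 16 * t * ‖rowSum x N z 0‖ ^ 2 := by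
    have := mul_self_le_mul_self (by positivity) h4
    nlinarith [Real.mul_self_sqrt ht.le, Real.mul_self_sqrt hv.le, Real.mul_self_sqrt hN.le]
  rw [div_le_div_iff₀ (by positivity) hN]
  linarith

/-- A stationary solution of the planar autoregression driven by nondegenerate white noise exists
only if the characteristic polynomial has no zeros on the torus. -/
theorem symbol_ne_zero_of_stationary {a b c v : ℝ} (hv : 0 < v) {x e : ℤ → ℤ → E} {g : ℤ → ℝ}
    (hg : ∀ i k j, ⟪x i j, x k j⟫_ℂ = (g (i - k) : ℂ))
    (he : ∀ i j, x i j = (a : ℂ) • x (i - 1) j + (b : ℂ) • x i (j - 1) +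
      (c : ℂ) • x (i - 1) (j - 1) + e i j)
    (ho : ∀ i j k l, (i, j) ≠ (k, l) → ⟪e i j, e k l⟫_ℂ = 0) (hev : ∀ i j, ‖e i j‖ ^ 2 = v) :
    2 * |a + b * c| < |1 + a ^ 2 - b ^ 2 - c ^ 2| := by
  by_contra! hle
  set α := 1 + a ^ 2 - b ^ 2 - c ^ 2 with hα
  set β := a + b * c with hβ
  obtain ⟨θ₀, hθ₀, hαβ⟩ : ∃ θ₀ ∈ Set.Icc 0 (2 * Real.pi), α = 2 * β * Real.cos θ₀ := by
    refine ⟨Real.arccos (α / (2 * β)), ⟨Real.arccos_nonneg _, ?_⟩, ?_⟩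
    · linarith [Real.arccos_le_pi (α / (2 * β)), Real.pi_pos]
    · have h1 : |α / (2 * β)| ≤ 1 := by
        rw [abs_div, abs_mul, abs_two]
        exact div_le_one_of_le₀ hle (by positivity)
      rw [abs_le] at h1
      rw [Real.cos_arccos h1.1 h1.2]
      -- If `β = 0`, the assumed inequality forces `α = 0`, so any angle is a zero.
      by_cases hb : β = 0
      · rw [hb] at hle ⊢; simpa using hle
      · field_simp
  set K : ℝ := 2 * |β| + 1 with hK
  have hK0 : 0 < K := by positivity
  have hbound : ∀ θ, |α - 2 * β * Real.cos θ| ≤ K * |θ - θ₀| := by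
    intro θ
    rw [hαβ, ← mul_sub, abs_mul, abs_mul, abs_two, abs_sub_comm]
    exact mul_le_mul (by linarith) (Real.abs_cos_sub_cos_le _ _) (abs_nonneg _) hK0.le
  have hpt : ∀ θ : ℝ, ENNReal.ofReal (v / (16 * K) * |θ - θ₀|⁻¹) ≤
      liminf (fun N : ℕ => ENNReal.ofReal
        (‖rowSum x N (Complex.exp (θ * Complex.I)) 0‖ ^ 2 / N)) atTop := by
    intro θ
    rcases eq_or_ne θ θ₀ with rfl | hne
    -- At `θ₀` itself the convention `0⁻¹ = 0` makes the bound trivial.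
    · simp
    have hpos : 0 < |θ - θ₀| := abs_pos.2 (sub_ne_zero.2 hne)
    refine le_liminf_of_le (by isBoundedDefault) ?_
    filter_upwards [eventually_le_norm_sq_rowSum hv hg he ho hev (mul_pos hK0 hpos) (hbound θ)]
      with N hN
    refine ENNReal.ofReal_le_ofReal (le_trans (le_of_eq ?_) hN)
    field_simp
  have hint : ∀ N : ℕ, 0 < N → ∫⁻ θ in Set.Ioc 0 (2 * Real.pi), ENNReal.ofReal
        (‖rowSum x N (Complex.exp (θ * Complex.I)) 0‖ ^ 2 / N) =
        ENNReal.ofReal (2 * Real.pi * g 0) := by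
    intro N hN
    have hcont : Continuous fun θ : ℝ =>
        ‖rowSum x N (Complex.exp (θ * Complex.I)) 0‖ ^ 2 / N :=
      ((continuous_rowSum_exp x N 0).norm.pow 2).div_const _
    rw [← ofReal_integral_eq_lintegral_ofReal]
    · rw [← intervalIntegral.integral_of_le (by positivity), intervalIntegral.integral_div,
        integral_norm_sq_rowSum hg]
      congr 1
      field_simp
    · exact (hcont.intervalIntegrable 0 (2 * Real.pi)).1
    · exact Eventually.of_forall fun θ => by positivity
  have htop := lintegral_inv_abs_sub_eq_top (a := 0) (b := 2 * Real.pi) (x₀ := θ₀)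
    (C := v / (16 * K)) (by positivity) hθ₀ (by positivity)
  have hfatou : ∫⁻ θ in Set.Ioc 0 (2 * Real.pi), ENNReal.ofReal (v / (16 * K) * |θ - θ₀|⁻¹) ≤
      ENNReal.ofReal (2 * Real.pi * g 0) := by
    refine (lintegral_mono hpt).trans ((lintegral_liminf_le fun N => ?_).trans ?_)
    · exact (((continuous_rowSum_exp x N 0).norm.pow 2).div_const _).measurable.ennreal_ofReal
    · refine liminf_le_of_frequently_le' (Eventually.frequently ?_)
      filter_upwards [eventually_gt_atTop 0] with N hN
      exact (hint N hN).le
  rw [htop] at hfatou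
  exact ENNReal.ofReal_ne_top (top_le_iff.1 hfatou)

end Spectral

/-! ### From a nonvanishing symbol to causality -/

section Reversal

/-- Use `α - 2β = (1 - a)² - (b + c)²` and `α + 2β = (1 + a)² - (b - c)²`. Multiplying the two
comparisons compares `(1 - a²)²` with `(b² - c²)²`. When `α ≥ 0`, `|a| ≥ 1` would contradict `habc`;
when `α < 0`, either `habc` or `|c| ≤ 1` fails. -/
theorem causal_of_symbol_ne_zero {a b c : ℝ} (hc : |c| ≤ 1) (habc : a ^ 2 + b ^ 2 < 1 + c ^ 2)
    (h : 2 * |a + b * c| < |1 + a ^ 2 - b ^ 2 - c ^ 2|) :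
    |a| < 1 ∧ 2 * |a + b * c| < 1 + a ^ 2 - b ^ 2 - c ^ 2 := by
  have hc2 : c ^ 2 ≤ 1 := (sq_le_one_iff_abs_le_one c).2 hc
  rcases abs_cases (1 + a ^ 2 - b ^ 2 - c ^ 2) with ⟨h1, -⟩ | ⟨h1, h2⟩
  · rw [h1] at h
    refine ⟨(sq_lt_one_iff_abs_lt_one a).1 ?_, h⟩
    have hp : 0 ≤ (1 - a) ^ 2 - (b + c) ^ 2 := by nlinarith [le_abs_self (a + b * c)]
    have hq : 0 < (1 + a) ^ 2 - (b - c) ^ 2 := by nlinarith [neg_abs_le (a + b * c)]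
    have hpq : (b ^ 2 - c ^ 2) ^ 2 ≤ (1 - a ^ 2) ^ 2 :=
      calc (b ^ 2 - c ^ 2) ^ 2 = (b + c) ^ 2 * (b - c) ^ 2 := by ring
        _ ≤ (1 - a) ^ 2 * (1 + a) ^ 2 := by
          exact mul_le_mul (by linarith) (by linarith) (sq_nonneg _) (sq_nonneg _)
        _ = (1 - a ^ 2) ^ 2 := by ring
    by_contra! hge
    have habs := sq_le_sq.1 hpq
    rw [abs_of_nonpos (by linarith : 1 - a ^ 2 ≤ 0)] at habs
    linarith [neg_abs_le (b ^ 2 - c ^ 2)]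
  · exfalso
    rw [h1] at h
    have hp : (1 - a) ^ 2 ≤ (b + c) ^ 2 := by nlinarith [neg_abs_le (a + b * c)]
    have hq : (1 + a) ^ 2 ≤ (b - c) ^ 2 := by nlinarith [le_abs_self (a + b * c)]
    have hpq : (1 - a ^ 2) ^ 2 ≤ (b ^ 2 - c ^ 2) ^ 2 :=
      calc (1 - a ^ 2) ^ 2 = (1 - a) ^ 2 * (1 + a) ^ 2 := by ring
        _ ≤ (b + c) ^ 2 * (b - c) ^ 2 := mul_le_mul hp hq (sq_nonneg _) (sq_nonneg _)
        _ = (b ^ 2 - c ^ 2) ^ 2 := by ring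
    have habs := (le_abs_self _).trans (sq_le_sq.1 hpq)
    rcases abs_cases (b ^ 2 - c ^ 2) with ⟨h3, -⟩ | ⟨h3, -⟩ <;> linarith

variable {E : Type*} [NormedAddCommGroup E] [InnerProductSpace ℝ E]

/-- The backward innovations, normalised by the coefficient of the corner term, have the same
Gram matrix as the forward ones up to a factor. -/
theorem inner_reversed_innovations {a b c : ℝ} (hc : c ≠ 0) (x e e' : ℤ → ℤ → E) {G : ℤ → ℤ → ℝ}
    (hG : ∀ i j k l, ⟪x i j, x k l⟫_ℝ = G (i - k) (j - l))
    (he : ∀ i j, x i j = a • x (i - 1) j + b • x i (j - 1) + c • x (i - 1) (j - 1) + e i j)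
    (he' : ∀ i j, x i j = (-b / c) • x (i - 1) j + (-a / c) • x i (j - 1) +
      (1 / c) • x (i - 1) (j - 1) + e' i j) (i j k l : ℤ) :
    ⟪e' i j, e' k l⟫_ℝ = ⟪e i j, e k l⟫_ℝ / c ^ 2 := by
  have h1 : ∀ i j, e i j =
      x i j - (a • x (i - 1) j + b • x i (j - 1) + c • x (i - 1) (j - 1)) := fun i j => by
    rw [eq_sub_iff_add_eq', ← he i j]
  have h2 : ∀ i j, e' i j = x i j - ((-b / c) • x (i - 1) j + (-a / c) • x i (j - 1) +
      (1 / c) • x (i - 1) (j - 1)) := fun i j => by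
    rw [eq_sub_iff_add_eq', ← he' i j]
  obtain ⟨p, rfl⟩ : ∃ p, i = k + p := ⟨i - k, by ring⟩
  obtain ⟨q, rfl⟩ : ∃ q, j = l + q := ⟨j - l, by ring⟩
  rw [h1, h1, h2, h2]
  simp only [inner_sub_left, inner_sub_right, inner_add_left, inner_add_right,
    real_inner_smul_left, real_inner_smul_right, hG]
  have e1 : k + p - k = p := by ring
  have e2 : l + q - l = q := by ring
  have e3 : k + p - 1 - k = p - 1 := by ring
  have e4 : l + q - 1 - l = q - 1 := by ring
  have e5 : k + p - (k - 1) = p + 1 := by ring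
  have e6 : l + q - (l - 1) = q + 1 := by ring
  have e7 : k + p - 1 - (k - 1) = p := by ring
  have e8 : l + q - 1 - (l - 1) = q := by ring
  simp only [e1, e2, e3, e4, e5, e6, e7, e8]
  field_simp
  ring

end Reversal

/-! ### Noise and innovation spaces -/

section Innovations

variable {Ω : Type*} [MeasurableSpace Ω] {μ : Measure Ω}

theorem mem_closedSpan (X : ℤ → ℤ → Ω → ℝ) (hM : ∀ i j, MemLp (X i j) 2 μ) {I : Set (ℤ × ℤ)}
    {i j : ℤ} (h : (i, j) ∈ I) : (hM i j).toLp (X i j) ∈ closedSpan X hM I :=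
  Submodule.le_topologicalClosure _ (Submodule.subset_span ⟨(i, j), h, rfl⟩)

theorem closedSpan_le {X : ℤ → ℤ → Ω → ℝ} {hM : ∀ i j, MemLp (X i j) 2 μ} {I : Set (ℤ × ℤ)}
    {K : Submodule ℝ (Lp ℝ 2 μ)} (hK : IsClosed (K : Set (Lp ℝ 2 μ)))
    (h : ∀ i j, (i, j) ∈ I → (hM i j).toLp (X i j) ∈ K) : closedSpan X hM I ≤ K := by
  refine Submodule.topologicalClosure_minimal _ (Submodule.span_le.2 ?_) hK
  rintro _ ⟨p, hp, rfl⟩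
  exact h p.1 p.2 hp

/-- A stationary family solving a causal planar autoregression with orthogonal innovations is
purely nondeterministic. -/
theorem isPurelyNondeterministic_of_causal {X : ℤ → ℤ → Ω → ℝ} (hM : ∀ i j, MemLp (X i j) 2 μ)
    {a b c : ℝ} (e : ℤ → ℤ → Lp ℝ 2 μ) {G : ℤ → ℤ → ℝ}
    (hG : ∀ i j k l, ⟪(hM i j).toLp (X i j), (hM k l).toLp (X k l)⟫_ℝ = G (i - k) (j - l))
    (he : ∀ i j, (hM i j).toLp (X i j) = a • (hM (i - 1) j).toLp (X (i - 1) j) +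
      b • (hM i (j - 1)).toLp (X i (j - 1)) +
      c • (hM (i - 1) (j - 1)).toLp (X (i - 1) (j - 1)) + e i j)
    (ho : ∀ i j k l, (i, j) ≠ (k, l) → ⟪e i j, e k l⟫_ℝ = 0)
    (ha : |a| < 1) (h : 2 * |a + b * c| < 1 + a ^ 2 - b ^ 2 - c ^ 2) :
    IsPurelyNondeterministic X μ := by
  have hcausal := mem_closure_span_innovations (fun i j => (hM i j).toLp (X i j)) e
    (fun i j k l => by rw [hG, hG]; congr 1; ring)
    ⟨√(G 0 0), fun i j => by
      rw [← Real.sqrt_sq (norm_nonneg _), ← real_inner_self_eq_norm_sq, hG]; simp⟩ he ha h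
  have he' : ∀ i j, e i j = (hM i j).toLp (X i j) - (a • (hM (i - 1) j).toLp (X (i - 1) j) +
      b • (hM i (j - 1)).toLp (X i (j - 1)) +
      c • (hM (i - 1) (j - 1)).toLp (X (i - 1) (j - 1))) := fun i j => by
    rw [eq_sub_iff_add_eq', ← he i j]
  have hmem : ∀ (I : Set (ℤ × ℤ)) i j, (i, j) ∈ I → (i - 1, j) ∈ I → (i, j - 1) ∈ I →
      (i - 1, j - 1) ∈ I → e i j ∈ closedSpan X hM I := by
    intro I i j h1 h2 h3 h4
    rw [he']
    exact sub_mem (mem_closedSpan X hM h1) (add_mem (add_mem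
      (Submodule.smul_mem _ _ (mem_closedSpan X hM h2))
      (Submodule.smul_mem _ _ (mem_closedSpan X hM h3)))
      (Submodule.smul_mem _ _ (mem_closedSpan X hM h4)))
  -- If `I` avoids the quadrant above `(i, j)`, the noise representing any `X k l` with `(k, l) ∈ I`
  -- never includes `e i j`.
  have horth : ∀ (I : Set (ℤ × ℤ)) i j, (∀ k l, (k, l) ∈ I → ¬ (i ≤ k ∧ j ≤ l)) →
      e i j ∈ (closedSpan X hM I)ᗮ := by
    intro I i j hI
    rw [Submodule.mem_orthogonal']
    have hle : closedSpan X hM I ≤ (ℝ ∙ e i j)ᗮ := by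
      refine closedSpan_le (Submodule.isClosed_orthogonal _) fun k l hkl => ?_
      refine Submodule.topologicalClosure_minimal _ (Submodule.span_le.2 ?_)
        (Submodule.isClosed_orthogonal _) (hcausal k l)
      rintro _ ⟨p, hp, rfl⟩
      rw [SetLike.mem_coe, Submodule.mem_orthogonal_singleton_iff_inner_right]
      refine ho _ _ _ _ fun heq => hI k l hkl ?_
      obtain ⟨rfl, rfl⟩ := Prod.mk.inj heq
      exact hp
    intro u hu
    exact (Submodule.mem_orthogonal_singleton_iff_inner_right).1 (hle hu)
  have hinn : ∀ i j, e i j ∈ innovationSpace X hM i j := by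
    intro i j
    refine ⟨⟨⟨hmem _ i j ?_ ?_ ?_ ?_, horth _ i j ?_⟩, hmem _ i j ?_ ?_ ?_ ?_⟩, horth _ i j ?_⟩
    all_goals simp
    all_goals intros; omega
  refine ⟨hM, le_antisymm ?_ ?_⟩
  · refine closedSpan_le (Submodule.isClosed_topologicalClosure _) fun i j _ => ?_
    refine Submodule.topologicalClosure_mono (Submodule.span_le.2 ?_) (hcausal i j)
    rintro _ ⟨p, _, rfl⟩
    exact Submodule.mem_iSup_of_mem p.1 (Submodule.mem_iSup_of_mem p.2 (hinn p.1 p.2))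
  · refine Submodule.topologicalClosure_minimal _ (iSup_le fun i => iSup_le fun j => ?_)
      (Submodule.isClosed_topologicalClosure _)
    refine (inf_le_left.trans (inf_le_left.trans inf_le_left)).trans ?_
    exact Submodule.topologicalClosure_mono (Submodule.span_mono (Set.image_mono
      (Set.subset_univ _)))

end Innovations

/-! ### Second moments as inner products, over `ℂ` for Fourier analysis and over `ℝ` for the
conclusion -/

section L2

variable {Ω : Type*} [MeasurableSpace Ω] {μ : Measure Ω}

theorem inner_toLp_ofReal {𝕜 : Type*} [RCLike 𝕜] {f g : Ω → ℝ} (hf : MemLp f 2 μ)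
    (hg : MemLp g 2 μ) :
    ⟪(hf.ofReal (K := 𝕜)).toLp _, (hg.ofReal (K := 𝕜)).toLp _⟫_𝕜 =
      ((∫ ω, f ω * g ω ∂μ : ℝ) : 𝕜) := by
  rw [L2.inner_def, ← integral_ofReal]
  refine integral_congr_ae ?_
  filter_upwards [(hf.ofReal (K := 𝕜)).coeFn_toLp, (hg.ofReal (K := 𝕜)).coeFn_toLp] with ω h1 h2
  rw [h1, h2]
  simp [mul_comm]

theorem integral_mul_eq_covariance_add [IsProbabilityMeasure μ] {f g : Ω → ℝ} (hf : MemLp f 2 μ)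
    (hg : MemLp g 2 μ) :
    ∫ ω, f ω * g ω ∂μ = covariance f g μ + (∫ ω, f ω ∂μ) * ∫ ω, g ω ∂μ := by
  rw [covariance_eq_sub hf hg, sub_add_cancel]
  rfl

theorem toLp_ofReal_ar {𝕜 : Type*} [RCLike 𝕜] {a b c : ℝ} {X ε : ℤ → ℤ → Ω → ℝ}
    (hM : ∀ i j, MemLp (X i j) 2 μ) (hε : ∀ i j, MemLp (ε i j) 2 μ)
    (hAR : SatisfiesAR a b c X ε μ) (i j : ℤ) :
    ((hM i j).ofReal (K := 𝕜)).toLp _ =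
      (a : 𝕜) • ((hM (i - 1) j).ofReal (K := 𝕜)).toLp _ +
      (b : 𝕜) • ((hM i (j - 1)).ofReal (K := 𝕜)).toLp _ +
      (c : 𝕜) • ((hM (i - 1) (j - 1)).ofReal (K := 𝕜)).toLp _ +
      ((hε i j).ofReal (K := 𝕜)).toLp _ := by
  rw [← MemLp.toLp_const_smul, ← MemLp.toLp_const_smul, ← MemLp.toLp_const_smul,
    ← MemLp.toLp_add, ← MemLp.toLp_add, ← MemLp.toLp_add]
  refine MemLp.toLp_congr _ _ ?_
  filter_upwards [hAR i j] with ω h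
  simp [h]

end L2

end PlanarAR

theorem mainTheorem12 {Ω : Type*} [MeasurableSpace Ω] (μ : MeasureTheory.Measure Ω)
    [MeasureTheory.IsProbabilityMeasure μ] (a b c v : ℝ) (hv : 0 < v)
    (X ε : ℤ → ℤ → Ω → ℝ)
    (hX : PlanarAR.IsStationaryField X μ)
    (hε : PlanarAR.IsWhiteNoise ε v μ)
    (hAR : PlanarAR.SatisfiesAR a b c X ε μ)
    (habc : 1 + c ^ 2 > a ^ 2 + b ^ 2) :
    PlanarAR.IsPurelyNondeterministic X μ := by
  open PlanarAR in
  have hM := hX.memLp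
  obtain ⟨m, hm⟩ := hX.mean
  obtain ⟨γ, hγ⟩ := hX.autocov
  -- Uncentred moments are also functions of the lag because the mean is constant, so `X` need not
  -- be centred.
  have hXX : ∀ i j k l, ∫ ω, X i j ω * X k l ω ∂μ = γ (i - k) (j - l) + m * m := by
    intro i j k l
    rw [integral_mul_eq_covariance_add (hM i j) (hM k l), hm, hm, ← hγ i j (i - k) (j - l),
      sub_sub_cancel, sub_sub_cancel]
  have hεo : ∀ i j k l, (i, j) ≠ (k, l) → ∫ ω, ε i j ω * ε k l ω ∂μ = 0 := by
    intro i j k l hne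
    rw [integral_mul_eq_covariance_add (hε.memLp i j) (hε.memLp k l), hε.uncorrelated i j k l hne,
      hε.mean_zero, zero_mul, add_zero]
  have hεv : ∀ i j, ∫ ω, ε i j ω * ε i j ω ∂μ = v := by
    intro i j
    rw [integral_mul_eq_covariance_add (hε.memLp i j) (hε.memLp i j), covariance_self
      (hε.memLp i j).aestronglyMeasurable.aemeasurable, hε.variance_eq, hε.mean_zero, zero_mul,
      add_zero]
  have hsymb : 2 * |a + b * c| < |1 + a ^ 2 - b ^ 2 - c ^ 2| := by
    refine symbol_ne_zero_of_stationary (E := Lp ℂ 2 μ) hv (g := fun h => γ h 0 + m * m) ?_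
      (toLp_ofReal_ar (𝕜 := ℂ) hM hε.memLp hAR) ?_ ?_
    · intro i k j
      refine (inner_toLp_ofReal (hM i j) (hM k j)).trans ?_
      rw [hXX, sub_self]; rfl
    · intro i j k l hne
      refine (inner_toLp_ofReal (hε.memLp i j) (hε.memLp k l)).trans ?_
      rw [hεo i j k l hne]; simp
    · intro i j
      rw [← inner_self_eq_norm_sq (𝕜 := ℂ)]
      refine (congrArg _ (inner_toLp_ofReal (hε.memLp i j) (hε.memLp i j))).trans ?_
      rw [hεv]; simp
  have hG : ∀ i j k l, inner ℝ ((hM i j).toLp (X i j)) ((hM k l).toLp (X k l)) =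
      γ (i - k) (j - l) + m * m := fun i j k l =>
    (inner_toLp_ofReal (𝕜 := ℝ) (hM i j) (hM k l)).trans (hXX i j k l)
  have he := toLp_ofReal_ar (𝕜 := ℝ) hM hε.memLp hAR
  have ho : ∀ i j k l, (i, j) ≠ (k, l) →
      inner ℝ ((hε.memLp i j).toLp (ε i j)) ((hε.memLp k l).toLp (ε k l)) = 0 :=
    fun i j k l hne => (inner_toLp_ofReal (𝕜 := ℝ) (hε.memLp i j) (hε.memLp k l)).trans
      (hεo i j k l hne)
  rcases le_or_gt |c| 1 with hc | hc
  · obtain ⟨ha, h⟩ := causal_of_symbol_ne_zero hc habc hsymb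
    exact isPurelyNondeterministic_of_causal hM _ (G := fun h k => γ h k + m * m) hG he ho ha h
  · have hc0 : c ≠ 0 := by rintro rfl; simp at hc; linarith
    have hc2 : 0 < c ^ 2 := by positivity
    obtain ⟨ha, h⟩ := causal_of_symbol_ne_zero (a := -b / c) (b := -a / c) (c := 1 / c)
      (by rw [abs_div, abs_one]; exact div_le_one_of_le₀ hc.le (abs_nonneg c))
      (by
        have : 1 + (1 / c) ^ 2 - ((-b / c) ^ 2 + (-a / c) ^ 2) =
          (1 + c ^ 2 - (a ^ 2 + b ^ 2)) / c ^ 2 := by field_simp; ring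
        have h0 : 0 < (1 + c ^ 2 - (a ^ 2 + b ^ 2)) / c ^ 2 := div_pos (by linarith) hc2
        linarith)
      (by
        have h1 : -b / c + -a / c * (1 / c) = -(a + b * c) / c ^ 2 := by field_simp; ring
        have h2 : 1 + (-b / c) ^ 2 - (-a / c) ^ 2 - (1 / c) ^ 2 =
          -(1 + a ^ 2 - b ^ 2 - c ^ 2) / c ^ 2 := by field_simp; ring
        rw [h1, h2, abs_div, abs_div, abs_neg, abs_neg, ← mul_div_assoc]
        gcongr)
    set x : ℤ → ℤ → Lp ℝ 2 μ := fun i j => (hM i j).toLp (X i j) with hx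
    -- The new noise is defined as the residual; only its orthogonality has to be proved.
    have he' : ∀ i j, x i j = (-b / c) • x (i - 1) j + (-a / c) • x i (j - 1) +
        (1 / c) • x (i - 1) (j - 1) + (x i j - ((-b / c) • x (i - 1) j + (-a / c) • x i (j - 1) +
        (1 / c) • x (i - 1) (j - 1))) := fun i j => (add_sub_cancel _ _).symm
    refine isPurelyNondeterministic_of_causal hM _ (G := fun h k => γ h k + m * m) hG he' ?_ ha h
    intro i j k l hne
    refine (inner_reversed_innovations hc0 x _ _ (G := fun h k => γ h k + m * m) hG he he'
      i j k l).trans ?_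
    exact (congrArg (· / c ^ 2) (ho i j k l hne)).trans (zero_div _)
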